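/- Let $k$ be a field of characteristic $p\ge 0$, let $V=V_{\bar 0}\oplus V_{\bar 1}$ be a superspace over $k$ with $\dim V_{\bar 0}=m$, $\dim V_{\bar 1}=n$, fix an ordered homogeneous basis $v_1,\dots,v_{m+n}$ of $V$ with parities $\bar v_i\in\mathbb Z/2$, and let $G=GL(V)$. Let $U_{\mathbb C}$ be the universal enveloping superalgebra of the complex Lie superalgebra with basis the matrix units $e_{i,j}$ ($1\le i,j\le m+n$) of parity $\bar v_i+\bar v_j$ and bracket $[e_{i,j},e_{k,l}]=\delta_{j,k}e_{i,l}-(-1)^{(\bar v_i+\bar v_j)(\bar v_k+\bar v_l)}\delta_{i,l}e_{k,j}$. With $h_i=e_{i,i}$, let $U_{\mathbb Z}\subset U_{\mathbb C}$ be the subring generated by the $e_{i,j}$ with $\bar v_i+\bar v_j=\bar 1$, the $e_{i,j}^{(r)}=e_{i,j}^r/r!$ with $i\ne j$, $\bar v_i+\bar v_j=\bar 0$, $r\ge 1$, and the $\binom{h_i}{r}$ with $r\ge1$; put $\mathrm{Dist}(G)=k\otimes_{\mathbb Z}U_{\mathbb Z}$. Let $\mathrm{Dist}(B)$ be the subalgebra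 generated by all $\binom{h_i}{r}$ and by those of the above elements $e_{i,j}$, $e_{i,j}^{(r)}$ with $i<j$. Let $X(T)=\bigoplus_{i=1}^{m+n}\mathbb Z\varepsilon_i$ with the symmetric bilinear form $(\varepsilon_i,\varepsilon_j)=(-1)^{\bar v_i}\delta_{i,j}$. For $\lambda=\sum_i\lambda_i\varepsilon_i\in X(T)$ let $k_\lambda$ be the one-dimensional $\mathrm{Dist}(B)$-supermodule of degree $\bar 0$ on which $\binom{h_i}{r}$ acts as $\binom{\lambda_i}{r}$ and the $e_{i,j}$ and $e_{i,j}^{(r)}$ with $i<j$, $r\ge 1$, act as $0$. Let $M(\lambda)=\mathrm{Dist}(G)\otimes_{\mathrm{Dist}(B)}k_\lambda$ be the Verma module, and let $L(\lambda)=M(\lambda)/\operatorname{Rad}M(\lambda)$ be its irreducible quotient, where $\operatorname{Rad}M(\lambda)$ is the unique maximal (graded) submodule. Morphisms of supermodules are allowed to be even, odd, or sums of such. Let $P$ be the following free abelian group with elements $\gamma_a\in P$ $(a\in\mathbb Z)$. If $p=0$, $P=\bigoplus_{a\in\mathbb Z}\mathbb Z\gamma_a$. If $p>0$, $P=\mathbb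 Z\delta\oplus\bigoplus_{r\in\mathbb Z/p\mathbb Z}\mathbb Z\Lambda_r$ and $\gamma_a=\Lambda_s-\Lambda_{s-1}-d\delta$, where $a=pd+s$ with $d\in\mathbb Z$ and $1\le s\le p$ (indices of $\Lambda$ are read modulo $p$). Let $$\rho=\sum_{j=1}^{m+n}\Big(\sum_{i=j+1}^{m+n}(-1)^{\bar v_i+\bar v_j}\Big)\varepsilon_j+\sum_{i:\,\bar v_i=\bar 0}\varepsilon_i ,\qquad \operatorname{wt}(\lambda)=\sum_{i=1}^{m+n}(-1)^{\bar v_i}\gamma_{(\lambda+\rho,\varepsilon_i)}\in P .$$ Theorem. Let $\lambda,\mu\in X(T)$. If $L(\mu)$ is a composition factor (that is, isomorphic to an irreducible subquotient) of $M(\lambda)$, then $\operatorname{wt}(\lambda)=\operatorname{wt}(\mu)$. -/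

import Mathlib

open scoped TensorProduct

noncomputable section

namespace GLSuper

/-- The sign `(-1)^a` of a parity `a`. -/
def sgn (a : ZMod 2) : ℤ := if a = 0 then 1 else -1

/-! ### Weights of the diagonal torus

Throughout, `v i` is the parity of the `i`-th vector of an ordered homogeneous basis of the
superspace `V`; so `dim V = (m|n)`, with `m` the number of `i` with `v i = 0` and `n` the number
of `i` with `v i = 1`, and `N = m + n`. -/

/-- The character lattice `X(T) = ⨁ ℤ ε_i`. -/
abbrev XT (N : ℕ) : Type := Fin N → ℤ

/-- The basis element `ε_i` of `X(T)`. -/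
def eps {N : ℕ} (i : Fin N) : XT N := Pi.single i 1

/-- The symmetric bilinear form on `X(T)` with `(ε_i, ε_j) = (-1)^{v_i} δ_{ij}`. -/
def form {N : ℕ} (v : Fin N → ZMod 2) (x y : XT N) : ℤ := ∑ i, sgn (v i) * x i * y i

/-- `ϑ_j = ∑_{i > j} (-1)^{v_i + v_j}`. -/
def theta {N : ℕ} (v : Fin N → ZMod 2) : XT N :=
  fun j => ∑ i ∈ Finset.univ.filter (fun i => j < i), sgn (v i + v j)

/-- `ρ = ϑ + ∑_{v_i = 0} ε_i`. -/
def rho {N : ℕ} (v : Fin N → ZMod 2) : XT N :=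
  theta v + ∑ i ∈ Finset.univ.filter (fun i => v i = 0), eps i

/-! ### The weight lattice of the affine Lie algebra and the crystal weight function -/

/-- The weight lattice `P`: for `p = 0` it is free on the `γ_r` (`r ∈ ℤ`); for `p > 0` it is
`ℤ δ ⊕ ⨁_{r ∈ ℤ/p} ℤ Λ_r` (first component: the coefficient of `δ`). -/
def WeightLattice : ℕ → Type
  | 0 => ℤ →₀ ℤ
  | q + 1 => ℤ × (ZMod (q + 1) →₀ ℤ)

instance instAddCommGroupWeightLattice : (p : ℕ) → AddCommGroup (WeightLattice p)
  | 0 => inferInstanceAs (AddCommGroup (ℤ →₀ ℤ))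
  | q + 1 => inferInstanceAs (AddCommGroup (ℤ × (ZMod (q + 1) →₀ ℤ)))

/-- The elements `γ_a` of `P`. For `p = 0` they are the basis elements; for `p > 0` one writes
`a = p d + s` with `1 ≤ s ≤ p`, that is `d = ⌊(a - 1) / p⌋`, and puts
`γ_a = Λ_s - Λ_{s-1} - d δ`. -/
def gamma : (p : ℕ) → ℤ → WeightLattice p
  | 0, a => (Finsupp.single a 1 : ℤ →₀ ℤ)
  | q + 1, a =>
    ((-((a - 1) / ((q + 1 : ℕ) : ℤ)),
      Finsupp.single (a : ZMod (q + 1)) 1 - Finsupp.single ((a - 1 : ℤ) : ZMod (q + 1)) 1) :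
        ℤ × (ZMod (q + 1) →₀ ℤ))

/-- The weight function `wt(λ) = ∑_i (-1)^{v_i} γ_{(λ + ρ, ε_i)}`. -/
def wt (p : ℕ) {N : ℕ} (v : Fin N → ZMod 2) (lam : XT N) : WeightLattice p :=
  ∑ i, sgn (v i) • gamma p (form v (lam + rho v) (eps i))

/-! ### The universal enveloping superalgebra over `ℂ` -/

/-- The relations `x y - (-1)^{|x||y|} y x = [x, y]` between the matrix units, where
`[e_{ij}, e_{kl}] = δ_{jk} e_{il} - (-1)^{(v_i+v_j)(v_k+v_l)} δ_{il} e_{kj}`. -/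
inductive Rel {N : ℕ} (v : Fin N → ZMod 2) :
    FreeAlgebra ℂ (Fin N × Fin N) → FreeAlgebra ℂ (Fin N × Fin N) → Prop
  | bracket (i j k l : Fin N) :
      Rel v
        (FreeAlgebra.ι ℂ (i, j) * FreeAlgebra.ι ℂ (k, l)
          - sgn ((v i + v j) * (v k + v l)) •
              (FreeAlgebra.ι ℂ (k, l) * FreeAlgebra.ι ℂ (i, j)))
        ((if j = k then FreeAlgebra.ι ℂ (i, l) else 0)
          - sgn ((v i + v j) * (v k + v l)) •
              (if i = l then FreeAlgebra.ι ℂ (k, j) else 0))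

/-- The universal enveloping superalgebra `U_ℂ` of `𝔤𝔩(V)` over `ℂ`. -/
def UC {N : ℕ} (v : Fin N → ZMod 2) : Type := RingQuot (Rel v)

instance {N : ℕ} (v : Fin N → ZMod 2) : Ring (UC v) :=
  inferInstanceAs (Ring (RingQuot (Rel v)))

instance {N : ℕ} (v : Fin N → ZMod 2) : Algebra ℂ (UC v) :=
  inferInstanceAs (Algebra ℂ (RingQuot (Rel v)))

/-- The matrix unit `e_{ij}` in `U_ℂ`. -/
def e {N : ℕ} (v : Fin N → ZMod 2) (i j : Fin N) : UC v :=
  RingQuot.mkAlgHom ℂ (Rel v) (FreeAlgebra.ι ℂ (i, j))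

/-- The divided power `e_{ij}^{(r)} = e_{ij}^r / r!`. -/
def divPow {N : ℕ} (v : Fin N → ZMod 2) (i j : Fin N) (r : ℕ) : UC v :=
  ((r.factorial : ℂ)⁻¹) • e v i j ^ r

/-- The binomial `h_i (h_i - 1) ⋯ (h_i - r + 1) / r!`, where `h_i = e_{ii}`. -/
def hBinom {N : ℕ} (v : Fin N → ZMod 2) (i : Fin N) (r : ℕ) : UC v :=
  ((r.factorial : ℂ)⁻¹) • ((List.range r).map (fun s => e v i i - (s : UC v))).prod

/-- The homogeneous component of `U_ℂ` of parity `a`. -/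
def UCpart {N : ℕ} (v : Fin N → ZMod 2) (a : ZMod 2) : Submodule ℂ (UC v) :=
  Submodule.span ℂ {x | ∃ w : List (Fin N × Fin N),
    (w.map (fun q => v q.1 + v q.2)).sum = a ∧ x = (w.map (fun q => e v q.1 q.2)).prod}

/-! ### The Kostant form and the superalgebra of distributions -/

/-- The generators of the Kostant form. -/
inductive KostantGen {N : ℕ} (v : Fin N → ZMod 2) : UC v → Prop
  | odd (i j : Fin N) (h : v i + v j = 1) : KostantGen v (e v i j)
  | even (i j : Fin N) (hij : i ≠ j) (h : v i + v j = 0) (r : ℕ) (hr : 1 ≤ r) :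
      KostantGen v (divPow v i j r)
  | binom (i : Fin N) (r : ℕ) (hr : 1 ≤ r) : KostantGen v (hBinom v i r)

/-- The Kostant `ℤ`-form `U_ℤ` of `U_ℂ`. -/
def UZ {N : ℕ} (v : Fin N → ZMod 2) : Subalgebra ℤ (UC v) :=
  Algebra.adjoin ℤ {x | KostantGen v x}

theorem mem_UZ {N : ℕ} {v : Fin N → ZMod 2} {x : UC v} (hx : KostantGen v x) : x ∈ UZ v :=
  Algebra.subset_adjoin hx

/-- The superalgebra of distributions `Dist(G) = k ⊗_ℤ U_ℤ` of `G = GL(V)`. -/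
def Dist (k : Type*) [Field k] {N : ℕ} (v : Fin N → ZMod 2) := k ⊗[ℤ] (UZ v)

instance (k : Type*) [Field k] {N : ℕ} (v : Fin N → ZMod 2) : Ring (Dist k v) :=
  inferInstanceAs (Ring (k ⊗[ℤ] (UZ v)))

instance (k : Type*) [Field k] {N : ℕ} (v : Fin N → ZMod 2) : Algebra k (Dist k v) :=
  inferInstanceAs (Algebra k (k ⊗[ℤ] (UZ v)))

/-- The image `1 ⊗ u` in `Dist(G)` of an element `u` of `U_ℤ`. -/
def toDist (k : Type*) [Field k] {N : ℕ} (v : Fin N → ZMod 2) (u : UZ v) : Dist k v :=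
  (TensorProduct.tmul ℤ (1 : k) u : k ⊗[ℤ] (UZ v))

/-- The homogeneous component of `Dist(G)` of parity `a`. -/
def distPart (k : Type*) [Field k] {N : ℕ} (v : Fin N → ZMod 2) (a : ZMod 2) :
    Submodule k (Dist k v) :=
  Submodule.span k {x | ∃ u : UZ v, (u : UC v) ∈ UCpart v a ∧ x = toDist k v u}

/-! ### Supermodules

A `Dist(G)`-supermodule is a `Dist(G)`-module `M` with a grading `gr : ZMod 2 → Submodule k M`. -/

section Supermodules

variable {k : Type*} [Field k] {N : ℕ} {v : Fin N → ZMod 2}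
variable {M : Type*} [AddCommGroup M] [Module k M] [Module (Dist k v) M]
  [IsScalarTower k (Dist k v) M]
variable {M' : Type*} [AddCommGroup M'] [Module k M'] [Module (Dist k v) M']
  [IsScalarTower k (Dist k v) M']

/-- A graded submodule (a sub-supermodule): a submodule which contains the homogeneous components
of its elements. -/
def IsGradedSub (gr : ZMod 2 → Submodule k M) (S : Submodule (Dist k v) M) : Prop :=
  ∀ x ∈ S, ∃ y ∈ S, ∃ z ∈ S, y ∈ gr 0 ∧ z ∈ gr 1 ∧ x = y + z

/-- The grading induced on a submodule. -/
def subGrading (gr : ZMod 2 → Submodule k M) (S : Submodule (Dist k v) M) :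
    ZMod 2 → Submodule k S :=
  fun a => (gr a).comap (S.subtype.restrictScalars k)

/-- The grading induced on a quotient. -/
def quotGrading (gr : ZMod 2 → Submodule k M) (S : Submodule (Dist k v) M) :
    ZMod 2 → Submodule k (M ⧸ S) :=
  fun a => (gr a).map (S.mkQ.restrictScalars k)

/-- An irreducible supermodule: nonzero, and without graded submodules other than `0` and
itself. -/
def IsIrreducibleSuper (v : Fin N → ZMod 2) [Module (Dist k v) M]
    (gr : ZMod 2 → Submodule k M) : Prop :=
  Nontrivial M ∧ ∀ S : Submodule (Dist k v) M, IsGradedSub gr S → S = ⊥ ∨ S = ⊤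

/-- A homogeneous morphism of supermodules of parity `s`: a `k`-linear map of degree `s` with
`f (x m) = (-1)^{s |x|} x f(m)` for homogeneous `x` in `Dist(G)`. -/
def IsHomogeneousHom (v : Fin N → ZMod 2) [Module (Dist k v) M] [Module (Dist k v) M']
    (gr : ZMod 2 → Submodule k M) (gr' : ZMod 2 → Submodule k M')
    (s : ZMod 2) (f : M →ₗ[k] M') : Prop :=
  (∀ a, ∀ m ∈ gr a, f m ∈ gr' (a + s)) ∧
  (∀ a, ∀ x ∈ distPart k v a, ∀ m : M, f (x • m) = sgn (s * a) • (x • f m))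

/-- A morphism of supermodules: the sum of an even and an odd one. -/
def IsSuperHom (v : Fin N → ZMod 2) [Module (Dist k v) M] [Module (Dist k v) M']
    (gr : ZMod 2 → Submodule k M) (gr' : ZMod 2 → Submodule k M') (f : M →ₗ[k] M') : Prop :=
  ∃ f₀ f₁ : M →ₗ[k] M', IsHomogeneousHom v gr gr' 0 f₀ ∧ IsHomogeneousHom v gr gr' 1 f₁ ∧
    f = f₀ + f₁

/-- Isomorphism of supermodules (all morphisms are allowed, not only the even ones). -/
def SuperIso (v : Fin N → ZMod 2) [Module (Dist k v) M] [Module (Dist k v) M']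
    (gr : ZMod 2 → Submodule k M) (gr' : ZMod 2 → Submodule k M') : Prop :=
  ∃ f : M ≃ₗ[k] M', IsSuperHom v gr gr' (f : M →ₗ[k] M') ∧
    IsSuperHom v gr' gr (f.symm : M' →ₗ[k] M)

/-- `M'` is a composition factor of `M`: there are graded submodules `S ⊆ T` of `M` such that
`T / S` is irreducible and isomorphic to `M'`. -/
def IsCompositionFactor (v : Fin N → ZMod 2) [Module (Dist k v) M] [IsScalarTower k (Dist k v) M]
    [Module (Dist k v) M']
    (gr' : ZMod 2 → Submodule k M') (gr : ZMod 2 → Submodule k M) : Prop :=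
  ∃ S T : Submodule (Dist k v) M, S ≤ T ∧ IsGradedSub gr S ∧ IsGradedSub gr T ∧
    IsIrreducibleSuper v (quotGrading (subGrading gr T) (S.submoduleOf T)) ∧
    SuperIso v (quotGrading (subGrading gr T) (S.submoduleOf T)) gr'

end Supermodules

/-! ### Verma modules and their irreducible quotients -/

/-- The elements of `Dist(B)` that generate the annihilator of the canonical generator of `M(λ)`:
the differences of `binom(h_i, r)` and the scalars `binom(λ_i, r)`, and the
(divided powers of the) `e_{ij}` with `i < j`. -/
inductive VermaRel (k : Type*) [Field k] {N : ℕ} (v : Fin N → ZMod 2) (lam : XT N) :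
    Dist k v → Prop
  | torus (i : Fin N) (r : ℕ) (hr : 1 ≤ r) :
      VermaRel k v lam
        (toDist k v ⟨hBinom v i r, mem_UZ (.binom i r hr)⟩
          - algebraMap k (Dist k v) ((Ring.choose (lam i) r : ℤ) : k))
  | even (i j : Fin N) (hij : i < j) (h : v i + v j = 0) (r : ℕ) (hr : 1 ≤ r) :
      VermaRel k v lam (toDist k v ⟨divPow v i j r, mem_UZ (.even i j hij.ne h r hr)⟩)
  | odd (i j : Fin N) (hij : i < j) (h : v i + v j = 1) :
      VermaRel k v lam (toDist k v ⟨e v i j, mem_UZ (.odd i j h)⟩)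

/-- The left ideal of `Dist(G)` that annihilates the canonical generator of `M(λ)`. -/
def vermaIdeal (k : Type*) [Field k] {N : ℕ} (v : Fin N → ZMod 2) (lam : XT N) :
    Submodule (Dist k v) (Dist k v) :=
  Submodule.span (Dist k v) {x | VermaRel k v lam x}

/-- The Verma module `M(λ) = Dist(G) ⊗_{Dist(B)} k_λ`, where `k_λ` is the one-dimensional
`Dist(B)`-module of weight `λ`, presented as the quotient of `Dist(G)` by the left ideal generated
by the annihilator of `k_λ` in `Dist(B)`. -/
def Verma (k : Type*) [Field k] {N : ℕ} (v : Fin N → ZMod 2) (lam : XT N) :=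
  Dist k v ⧸ vermaIdeal k v lam

instance (k : Type*) [Field k] {N : ℕ} (v : Fin N → ZMod 2) (lam : XT N) :
    AddCommGroup (Verma k v lam) :=
  inferInstanceAs (AddCommGroup (Dist k v ⧸ vermaIdeal k v lam))

instance (k : Type*) [Field k] {N : ℕ} (v : Fin N → ZMod 2) (lam : XT N) :
    Module (Dist k v) (Verma k v lam) :=
  inferInstanceAs (Module (Dist k v) (Dist k v ⧸ vermaIdeal k v lam))

instance (k : Type*) [Field k] {N : ℕ} (v : Fin N → ZMod 2) (lam : XT N) :
    Module k (Verma k v lam) :=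
  inferInstanceAs (Module k (Dist k v ⧸ vermaIdeal k v lam))

instance (k : Type*) [Field k] {N : ℕ} (v : Fin N → ZMod 2) (lam : XT N) :
    IsScalarTower k (Dist k v) (Verma k v lam) :=
  inferInstanceAs (IsScalarTower k (Dist k v) (Dist k v ⧸ vermaIdeal k v lam))

/-- The grading of `M(λ)`; its canonical generator is even. -/
def vermaGrading (k : Type*) [Field k] {N : ℕ} (v : Fin N → ZMod 2) (lam : XT N) :
    ZMod 2 → Submodule k (Verma k v lam) :=
  quotGrading (distPart k v) (vermaIdeal k v lam)

/-- `Rad M(λ)`, the largest proper graded submodule, as the sum of all proper graded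
submodules. -/
def vermaRad (k : Type*) [Field k] {N : ℕ} (v : Fin N → ZMod 2) (lam : XT N) :
    Submodule (Dist k v) (Verma k v lam) :=
  sSup {S | IsGradedSub (vermaGrading k v lam) S ∧ S ≠ ⊤}

/-- The irreducible supermodule `L(λ) = M(λ) / Rad M(λ)` of highest weight `λ`. -/
def Irr (k : Type*) [Field k] {N : ℕ} (v : Fin N → ZMod 2) (lam : XT N) :=
  Verma k v lam ⧸ vermaRad k v lam

instance (k : Type*) [Field k] {N : ℕ} (v : Fin N → ZMod 2) (lam : XT N) :
    AddCommGroup (Irr k v lam) :=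
  inferInstanceAs (AddCommGroup (Verma k v lam ⧸ vermaRad k v lam))

instance (k : Type*) [Field k] {N : ℕ} (v : Fin N → ZMod 2) (lam : XT N) :
    Module (Dist k v) (Irr k v lam) :=
  inferInstanceAs (Module (Dist k v) (Verma k v lam ⧸ vermaRad k v lam))

instance (k : Type*) [Field k] {N : ℕ} (v : Fin N → ZMod 2) (lam : XT N) :
    Module k (Irr k v lam) :=
  inferInstanceAs (Module k (Verma k v lam ⧸ vermaRad k v lam))

instance (k : Type*) [Field k] {N : ℕ} (v : Fin N → ZMod 2) (lam : XT N) :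
    IsScalarTower k (Dist k v) (Irr k v lam) :=
  inferInstanceAs (IsScalarTower k (Dist k v) (Verma k v lam ⧸ vermaRad k v lam))

/-- The grading of `L(λ)`. -/
def irrGrading (k : Type*) [Field k] {N : ℕ} (v : Fin N → ZMod 2) (lam : XT N) :
    ZMod 2 → Submodule k (Irr k v lam) :=
  quotGrading (vermaGrading k v lam) (vermaRad k v lam)

end GLSuper

end

/-!
An even element of the Kostant form which is central in `U_ℂ` stays central in `Dist(G)`, so it acts
on `M(λ)` by a scalar, the one by which it acts on the canonical generator. If `L(μ)` is a
composition factor of `M(λ)`, the scalars for `λ` and `μ` agree in `k`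
(`eigenvalue_eq_of_isCompositionFactor`). Two families of such elements suffice.

* The Gelfand invariants `z_r`, traces of the (signed) powers of the matrix `(e_{ij})`
  (`commute_gelfandInv`). They are integral polynomials in the `e_{ij}`. On a highest weight vector
  of weight `λ`, put `a_i = (λ + ρ, ε_i)` and let `χ_λ(z_r)` be the eigenvalue of `z_r`; then
  `1 - ∑_r χ_λ(z_r) u^{r+1} = ∏_i ((1 - a_i u) / (1 - (a_i - 1) u))^{(-1)^{v_i}}`
  (`eigSeries_prod`). In the variable `1 / u` the divisor of this rational function over `k` is
  `∑_i (-1)^{v_i} ([a_i] - [a_i - 1])`, and so this sum depends only on the scalars. For `p > 0` it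
  is the component of `wt(λ)` in `⨁ ℤ Λ_r`; for `p = 0` it determines `∑_i (-1)^{v_i} [a_i]`,
  which is `wt(λ)`.
* The binomials of the Euler element `∑_i h_i`, which lie in the Kostant form by the Chu–Vandermonde
  identity (`choose_sum_mem_and_smul`). They act by the binomials of `∑_i λ_i`, whose residues
  determine the integer `∑_i λ_i` (`eq_of_choose_cast_eq`), hence `∑_i (-1)^{v_i} a_i`. For `p > 0`
  this number, together with the residues of the `a_i`, gives the coefficient of `δ`
  (`sum_sgn_mul_floor_eq`).
-/

open scoped TensorProduct

noncomputable section

namespace GLSuper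

/-! ### Signs -/

theorem sgn_add (a b : ZMod 2) : sgn (a + b) = sgn a * sgn b := by
  revert a b; decide

theorem sgn_mul_self (a : ZMod 2) : sgn a * sgn a = 1 := by
  revert a; decide

theorem sgn_mul_parity_add (a b c d : ZMod 2) :
    sgn (a * (b + c)) * sgn (a * (c + d)) = sgn (a * (b + d)) := by
  revert a b c d; decide

theorem sgn_mul_sgn_parity (a b i : ZMod 2) :
    sgn a * sgn ((a + b) * (i + a)) = sgn b * sgn ((a + b) * (i + b)) := by
  revert a b i; decide

/-! ### Gelfand invariants -/

section Gelfand

variable {N : ℕ} {v : Fin N → ZMod 2} {A : Type*} [Ring A] {E : Fin N → Fin N → A}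

/-- The family `E` of elements of a ring satisfies the supercommutation relations of the matrix
units of `𝔤𝔩(V)`. -/
def SuperRelations (v : Fin N → ZMod 2) (E : Fin N → Fin N → A) : Prop :=
  ∀ i j k l, E i j * E k l - sgn ((v i + v j) * (v k + v l)) • (E k l * E i j) =
    (if j = k then E i l else 0) -
      sgn ((v i + v j) * (v k + v l)) • (if i = l then E k j else 0)

/-- The entries of the `r`-th power of the matrix `E`, with the sign `(-1)^{v_k}` attached to each
summation index `k`. For this sign the entries of every power transform under the adjoint
action of the `E a b` in the same way as the entries of `E` itself; the zeroth power has to be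
the diagonal matrix of the `(-1)^{v_i}`. -/
def gelfandPower (v : Fin N → ZMod 2) (E : Fin N → Fin N → A) : ℕ → Fin N → Fin N → A
  | 0, i, j => if i = j then sgn (v i) • 1 else 0
  | r + 1, i, j => ∑ k, sgn (v k) • (E i k * gelfandPower v E r k j)

/-- The Gelfand invariant: the trace of `gelfandPower v E r`. -/
def gelfandInv (v : Fin N → ZMod 2) (E : Fin N → Fin N → A) (r : ℕ) : A :=
  ∑ i, gelfandPower v E r i i

theorem map_gelfandPower {B : Type*} [Ring B] (f : A →+* B) (r : ℕ) (i j : Fin N) :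
    f (gelfandPower v E r i j) = gelfandPower v (fun i j => f (E i j)) r i j := by
  induction r generalizing i with
  | zero => simp only [gelfandPower]; split_ifs <;> simp
  | succ r ih => simp [gelfandPower, ih]

theorem map_gelfandInv {B : Type*} [Ring B] (f : A →+* B) (r : ℕ) :
    f (gelfandInv v E r) = gelfandInv v (fun i j => f (E i j)) r := by
  simp [gelfandInv, map_gelfandPower]

/-- The entries of every power transform under the adjoint action like the matrix units. -/
theorem gelfandPower_bracket (hE : SuperRelations v E) (r : ℕ) (a b i j : Fin N) :
    E a b * gelfandPower v E r i j -
        sgn ((v a + v b) * (v i + v j)) • (gelfandPower v E r i j * E a b) =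
      (if b = i then gelfandPower v E r a j else 0) -
        sgn ((v a + v b) * (v i + v j)) • (if a = j then gelfandPower v E r i b else 0) := by
  induction r generalizing i with
  | zero =>
    simp only [gelfandPower]
    by_cases hij : i = j
    · subst hij
      have h1 : sgn ((v a + v b) * (v i + v i)) = 1 := by
        generalize v a = x; generalize v b = y; generalize v i = z
        revert x y z; decide
      rw [h1]
      simp only [if_true, one_smul, mul_smul_comm, smul_mul_assoc, mul_one, one_mul, sub_self]
      by_cases hbi : b = i
      · subst hbi
        by_cases hab : a = b
        · subst hab
          simp only [if_true, sub_self]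
        · simp only [hab, if_true, if_false, sub_self]
      · simp only [hbi, Ne.symm hbi, if_false, ite_self, sub_self]
    · by_cases hbi : b = i
      · subst hbi
        by_cases haj : a = j
        · subst haj
          have h1 : sgn ((v a + v b) * (v b + v a)) * sgn (v b) = sgn (v a) := by
            generalize v a = x; generalize v b = y
            revert x y; decide
          simp only [hij, if_true, if_false, smul_smul, h1, mul_zero, zero_mul, smul_zero, sub_self]
        · simp [hij, haj]
      · by_cases haj : a = j
        · simp [hij, hbi, haj, Ne.symm hbi]
        · simp [hij, hbi, haj]
  | succ r ih =>
    have key : ∀ k, E a b * (E i k * gelfandPower v E r k j) =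
        sgn ((v a + v b) * (v i + v j)) • (E i k * gelfandPower v E r k j * E a b) +
        (if b = i then E a k * gelfandPower v E r k j else 0) -
        sgn ((v a + v b) * (v i + v j)) •
          (if a = j then E i k * gelfandPower v E r k b else 0) +
        ((if b = k then sgn ((v a + v b) * (v i + v k)) • (E i k * gelfandPower v E r a j) else 0) -
        (if a = k then sgn ((v a + v b) * (v i + v k)) • (E i b * gelfandPower v E r k j)
          else 0)) := by
      intro k
      have h1 := eq_add_of_sub_eq (hE a b i k)
      have h2 := eq_add_of_sub_eq (ih k)
      rw [← mul_assoc, h1, add_mul, sub_mul, smul_mul_assoc (sgn _) (E i k * E a b), mul_assoc,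
        h2, ← sgn_mul_parity_add (v a + v b) (v i) (v k) (v j)]
      split_ifs <;> simp only [mul_add, mul_sub, smul_add, smul_sub, mul_smul_comm, smul_mul_assoc,
        smul_smul, mul_assoc, mul_zero, zero_mul, smul_zero] <;> abel
    -- The two sums in which the index `k` is contracted cancel; this is what fixes the sign
    -- `(-1)^{v_k}` in `gelfandPower`.
    have hcancel : ∑ k, sgn (v k) •
        ((if b = k then sgn ((v a + v b) * (v i + v k)) • (E i k * gelfandPower v E r a j) else 0) -
        (if a = k then sgn ((v a + v b) * (v i + v k)) • (E i b * gelfandPower v E r k j)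
          else 0)) = 0 := by
      simp only [smul_sub, smul_ite, smul_zero, Finset.sum_sub_distrib, Finset.sum_ite_eq,
        Finset.mem_univ, if_true, smul_smul]
      rw [sgn_mul_sgn_parity, sub_self]
    have hsum : E a b * gelfandPower v E (r + 1) i j =
        ∑ k, sgn (v k) • (E a b * (E i k * gelfandPower v E r k j)) := by
      simp only [gelfandPower, Finset.mul_sum, mul_smul_comm]
    rw [hsum]
    simp_rw [key]
    simp_rw [smul_add (sgn _) (_ - _) (_ - _)]
    rw [Finset.sum_add_distrib, hcancel, add_zero]
    simp only [smul_add, smul_sub, Finset.sum_add_distrib, Finset.sum_sub_distrib]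
    rw [sub_eq_iff_eq_add]
    have e1 : ∑ k, sgn (v k) • sgn ((v a + v b) * (v i + v j)) •
        (E i k * gelfandPower v E r k j * E a b) =
        sgn ((v a + v b) * (v i + v j)) • (gelfandPower v E (r + 1) i j * E a b) := by
      simp only [gelfandPower, Finset.sum_mul, Finset.smul_sum, smul_mul_assoc]
      exact Finset.sum_congr rfl fun k _ => smul_comm _ _ _
    have e2 : ∑ k, sgn (v k) • (if b = i then E a k * gelfandPower v E r k j else 0) =
        if b = i then gelfandPower v E (r + 1) a j else 0 := by
      split_ifs <;> simp [gelfandPower]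
    have e3 : ∑ k, sgn (v k) • sgn ((v a + v b) * (v i + v j)) •
          (if a = j then E i k * gelfandPower v E r k b else 0) =
        sgn ((v a + v b) * (v i + v j)) •
          (if a = j then gelfandPower v E (r + 1) i b else 0) := by
      split_ifs
      · simp only [gelfandPower, Finset.smul_sum]
        exact Finset.sum_congr rfl fun k _ => smul_comm _ _ _
      · simp
    rw [e1, e2, e3]
    abel

theorem commute_gelfandInv (hE : SuperRelations v E) (r : ℕ) (a b : Fin N) :
    Commute (E a b) (gelfandInv v E r) := by
  have h := Finset.sum_congr (rfl : (Finset.univ : Finset (Fin N)) = _)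
    fun i (_ : i ∈ Finset.univ) => gelfandPower_bracket hE r a b i i
  have h1 : ∀ i, sgn ((v a + v b) * (v i + v i)) = 1 := by
    intro i
    rw [CharTwo.add_self_eq_zero, mul_zero]; rfl
  simp only [h1, one_smul, Finset.sum_sub_distrib, ← Finset.mul_sum, ← Finset.sum_mul,
    Finset.sum_ite_eq, Finset.mem_univ, if_true, sub_self] at h
  exact sub_eq_zero.mp h

/-! ### Eigenvalues of the Gelfand invariants on a highest weight vector -/

/-- The integer `(-1)^{v_i} λ_i + ∑_{k > i} (-1)^{v_k}`; it equals `(λ + ρ, ε_i)` if `v i = 1`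
and `(λ + ρ, ε_i) - 1` if `v i = 0`. -/
def shiftedCoord (v : Fin N → ZMod 2) (lam : XT N) (i : Fin N) : ℤ :=
  sgn (v i) * lam i + ∑ k ∈ Finset.univ.filter (fun k => i < k), sgn (v k)

/-- Up to the sign `(-1)^{v_i}`, the eigenvalue of the `i`-th diagonal entry of
`gelfandPower v E r` on a highest weight vector of weight `λ`. -/
def gelfandEig (v : Fin N → ZMod 2) (lam : XT N) : ℕ → Fin N → ℤ
  | 0, _ => 1
  | r + 1, i => shiftedCoord v lam i * gelfandEig v lam r i -
      ∑ k ∈ Finset.univ.filter (fun k => i < k), sgn (v k) * gelfandEig v lam r k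

theorem gelfandPower_smul_highest (hE : SuperRelations v E) {W : Type*} [AddCommGroup W]
    [Module A W] {lam : XT N} {w : W} (hdiag : ∀ i, E i i • w = lam i • w)
    (hup : ∀ i j, i < j → E i j • w = 0) (r : ℕ) :
    (∀ i j, i < j → gelfandPower v E r i j • w = 0) ∧
      ∀ i, gelfandPower v E r i i • w = (sgn (v i) * gelfandEig v lam r i) • w := by
  induction r with
  | zero =>
    refine ⟨fun i j hij => by simp [gelfandPower, hij.ne], fun i => ?_⟩
    simp only [gelfandPower, gelfandEig, if_true, smul_assoc, one_smul, mul_one]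
  | succ r ih =>
    obtain ⟨ih1, ih2⟩ := ih
    -- An entry `E i k` above the diagonal can be moved to the right, where it kills `w`.
    have hmove : ∀ i k j, i < k → (E i k * gelfandPower v E r k j) • w =
        gelfandPower v E r i j • w - sgn ((v i + v k) * (v k + v j)) •
          (if i = j then gelfandPower v E r k k • w else 0) := by
      intro i k j hik
      have h := congrArg (· • w) (gelfandPower_bracket hE r i k k j)
      simp only [sub_smul, smul_assoc, mul_smul, hup i k hik, smul_zero, sub_zero, if_true] at h
      rw [mul_smul, h]
      split_ifs <;> simp
    have hexp : ∀ i j, gelfandPower v E (r + 1) i j • w =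
        ∑ k, sgn (v k) • (E i k * gelfandPower v E r k j) • w := by
      intro i j
      simp only [gelfandPower, Finset.sum_smul, smul_assoc]
    constructor
    · intro i j hij
      rw [hexp]
      refine Finset.sum_eq_zero fun k _ => ?_
      rcases lt_or_ge k j with hkj | hkj
      · rw [mul_smul, ih1 k j hkj, smul_zero, smul_zero]
      · rw [hmove i k j (hij.trans_le hkj), ih1 i j hij]
        simp [hij.ne]
    · intro i
      have hk : ∀ k, sgn (v k) • (E i k * gelfandPower v E r k i) • w =
          ((if k = i then lam i * gelfandEig v lam r i else 0) +
            if i < k then sgn (v k) * sgn (v i) * gelfandEig v lam r i -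
              sgn (v i) * (sgn (v k) * gelfandEig v lam r k) else 0 : ℤ) • w := by
        intro k
        rcases lt_trichotomy k i with h | h | h
        · rw [mul_smul, ih1 k i h]
          simp [h.ne, h.not_gt]
        · subst h
          rw [mul_smul, ih2, smul_comm (E k k), hdiag, smul_smul, smul_smul]
          congr 1
          simp only [if_true, lt_irrefl, if_false, add_zero]
          linear_combination (lam k * gelfandEig v lam r k) * sgn_mul_self (v k)
        · have hs : sgn (v k) * sgn ((v i + v k) * (v k + v i)) * sgn (v k) =
              sgn (v i) * sgn (v k) := by
            generalize v i = x; generalize v k = y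
            revert x y; decide
          rw [hmove i k i h, ih2, if_pos rfl, ih2]
          simp only [h.ne', h, if_false, if_true, smul_smul, ← sub_smul, zero_add]
          congr 1
          linear_combination (- gelfandEig v lam r k) * hs
      rw [hexp]
      simp_rw [hk]
      rw [← Finset.sum_smul]
      congr 1
      rw [Finset.sum_add_distrib, Finset.sum_ite_eq' Finset.univ i, if_pos (Finset.mem_univ _),
        ← Finset.sum_filter, Finset.sum_sub_distrib, ← Finset.mul_sum, ← Finset.sum_mul,
        ← Finset.sum_mul, gelfandEig, shiftedCoord]
      linear_combination (- lam i * gelfandEig v lam r i) * sgn_mul_self (v i)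

theorem gelfandInv_smul_highest (hE : SuperRelations v E) {W : Type*} [AddCommGroup W]
    [Module A W] {lam : XT N} {w : W} (hdiag : ∀ i, E i i • w = lam i • w)
    (hup : ∀ i j, i < j → E i j • w = 0) (r : ℕ) :
    gelfandInv v E r • w = (∑ i, sgn (v i) * gelfandEig v lam r i) • w := by
  rw [gelfandInv, Finset.sum_smul, Finset.sum_smul]
  exact Finset.sum_congr rfl fun i _ => (gelfandPower_smul_highest hE hdiag hup r).2 i

end Gelfand

/-! ### The generating function of the eigenvalues -/

section GeneratingFunction

open PowerSeries

variable {N : ℕ} (v : Fin N → ZMod 2) (lam : XT N)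

/-- The generating function of the `gelfandEig v lam r i`, `r ≥ 0`. -/
def eigSeries (i : Fin N) : ℤ⟦X⟧ := PowerSeries.mk fun r => gelfandEig v lam r i

theorem eigSeries_recursion (i : Fin N) :
    (1 - C (shiftedCoord v lam i) * X) * eigSeries v lam i =
      1 - X * ∑ k ∈ Finset.univ.filter (fun k => i < k), C (sgn (v k)) * eigSeries v lam k := by
  ext r
  rw [sub_mul, one_mul, mul_comm (C _) X, mul_assoc]
  cases r with
  | zero => simp [eigSeries, gelfandEig]
  | succ r =>
    simp [coeff_succ_X_mul, eigSeries, gelfandEig, coeff_one, -map_intCast, -eq_intCast]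

/-- The recursion for `gelfandEig` involves only larger indices, so the product formula can be
proved by adding the indices one by one from the top; each new index contributes the factor
`1 - X (-1)^{v_a} / (1 - b_a X)` with `b_a = shiftedCoord v lam a`. -/
theorem eigSeries_prod_of_isUpperSet (S : Finset (Fin N)) (hS : IsUpperSet (S : Set (Fin N))) :
    (1 - X * ∑ k ∈ S, C (sgn (v k)) * eigSeries v lam k) *
        ∏ k ∈ S, (1 - C (shiftedCoord v lam k) * X) =
      ∏ k ∈ S, (1 - C (shiftedCoord v lam k + sgn (v k)) * X) := by
  induction S using Finset.induction_on_min with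
  | empty => simp
  | insert a s hs ih =>
    have has : a ∉ s := fun h => lt_irrefl _ (hs a h)
    have hfil : Finset.univ.filter (fun k => a < k) = s := by
      ext k
      simp only [Finset.mem_filter, Finset.mem_univ, true_and]
      refine ⟨fun h => ?_, hs k⟩
      have := hS h.le (by simp : a ∈ ((insert a s : Finset (Fin N)) : Set (Fin N)))
      simpa [h.ne'] using this
    have hup : IsUpperSet (s : Set (Fin N)) := by
      intro x y hxy hx
      have := hS hxy (by simp [Finset.mem_coe.mp hx] :
        x ∈ ((insert a s : Finset (Fin N)) : Set (Fin N)))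
      have hya : y ≠ a := ((hs x hx).trans_le hxy).ne'
      simpa [hya] using this
    rw [Finset.sum_insert has, Finset.prod_insert has, Finset.prod_insert has, ← ih hup]
    have hrec := eigSeries_recursion v lam a
    rw [hfil] at hrec
    rw [map_add]
    linear_combination (- X * C (sgn (v a)) *
      ∏ k ∈ s, (1 - C (shiftedCoord v lam k) * X)) * hrec

theorem eigSeries_prod :
    (1 - X * ∑ k, C (sgn (v k)) * eigSeries v lam k) *
        ∏ k, (1 - C (shiftedCoord v lam k) * X) =
      ∏ k, (1 - C (shiftedCoord v lam k + sgn (v k)) * X) :=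
  eigSeries_prod_of_isUpperSet v lam Finset.univ (by simp [isUpperSet_univ])

end GeneratingFunction

/-! ### From the generating function to the weight function -/

section Arithmetic

/-- The factors `1 - c X` of a product over a field can be recovered from the product, those with
`c = 0` included since the number of factors is fixed. -/
theorem map_eq_of_prod_one_sub_eq {k ι : Type*} [Field k] [Fintype ι] {f g : ι → k}
    (h : ∏ i, (1 - Polynomial.C (f i) * Polynomial.X) =
      ∏ i, (1 - Polynomial.C (g i) * Polynomial.X)) :
    (Finset.univ.val.map f : Multiset k) = Finset.univ.val.map g := by
  have key : ∀ f : ι → k,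
      Polynomial.aeval ((RatFunc.X : RatFunc k)⁻¹)
        (∏ i, (1 - Polynomial.C (f i) * Polynomial.X)) =
      ((RatFunc.X : RatFunc k)⁻¹) ^ Fintype.card ι *
        algebraMap (Polynomial k) (RatFunc k) (∏ i, (Polynomial.X - Polynomial.C (f i))) := by
    intro f
    rw [map_prod, map_prod, ← Finset.card_univ, ← Finset.prod_const, ← Finset.prod_mul_distrib]
    refine Finset.prod_congr rfl fun i _ => ?_
    have hX : (RatFunc.X : RatFunc k) ≠ 0 := RatFunc.X_ne_zero
    simp only [map_sub, map_one, map_mul, Polynomial.aeval_C, Polynomial.aeval_X,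
      RatFunc.algebraMap_X, RatFunc.algebraMap_C, RatFunc.algebraMap_eq_C]
    field_simp
  have h1 := congrArg (Polynomial.aeval ((RatFunc.X : RatFunc k)⁻¹)) h
  rw [key, key] at h1
  have h2 := RatFunc.algebraMap_injective k
    (mul_left_cancel₀ (pow_ne_zero _ (inv_ne_zero RatFunc.X_ne_zero)) h1)
  have h3 : ∀ f : ι → k, (∏ i, (Polynomial.X - Polynomial.C (f i))).roots =
      Finset.univ.val.map f := by
    intro f
    rw [← Polynomial.roots_multiset_prod_X_sub_C (Finset.univ.val.map f), Multiset.map_map]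
    rfl
  rw [← h3, ← h3, h2]

variable {N : ℕ} {v : Fin N → ZMod 2}

/-- The generating functions of the eigenvalues for `λ` and `μ` are equal over `k`, hence so are the
divisors of these two rational functions in the variable `1 / X`; the sums are those of `f` over
the divisors. -/
theorem sum_shiftedCoord_eq_of_eig_eq {k : Type*} [Field k] {lam mu : XT N}
    (h : ∀ r, ((∑ i, sgn (v i) * gelfandEig v lam r i : ℤ) : k) =
      ((∑ i, sgn (v i) * gelfandEig v mu r i : ℤ) : k)) (f : k → ℤ) :
    ∑ i, (f ((shiftedCoord v lam i + sgn (v i) : ℤ) : k) - f (shiftedCoord v lam i : k)) =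
      ∑ i, (f ((shiftedCoord v mu i + sgn (v i) : ℤ) : k) - f (shiftedCoord v mu i : k)) := by
  have hser : PowerSeries.map (Int.castRingHom k)
        (1 - PowerSeries.X * ∑ i, PowerSeries.C (sgn (v i)) * eigSeries v lam i) =
      PowerSeries.map (Int.castRingHom k)
        (1 - PowerSeries.X * ∑ i, PowerSeries.C (sgn (v i)) * eigSeries v mu i) := by
    rw [map_sub, map_sub, map_mul, map_mul]
    congr 2
    ext r
    have := h r
    simpa [PowerSeries.coeff_map, eigSeries, -map_intCast, -eq_intCast] using this
  have hl := congrArg (PowerSeries.map (Int.castRingHom k)) (eigSeries_prod v lam)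
  have hm := congrArg (PowerSeries.map (Int.castRingHom k)) (eigSeries_prod v mu)
  rw [map_mul, hser] at hl
  rw [map_mul] at hm
  have hcast : ∀ g : Fin N → ℤ, PowerSeries.map (Int.castRingHom k)
      (∏ i, (1 - PowerSeries.C (g i) * PowerSeries.X)) =
      ((∏ i, (1 - Polynomial.C ((g i : ℤ) : k) * Polynomial.X) : Polynomial k) :
        PowerSeries k) := by
    intro g
    rw [map_prod, ← Polynomial.coeToPowerSeries.ringHom_apply, map_prod]
    refine Finset.prod_congr rfl fun i _ => ?_
    simp [-map_intCast, -eq_intCast, PowerSeries.map_C]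
  rw [hcast, hcast] at hl hm
  have hpoly : (∏ i, (1 - Polynomial.C ((shiftedCoord v lam i + sgn (v i) : ℤ) : k) *
        Polynomial.X)) *
      ∏ i, (1 - Polynomial.C (shiftedCoord v mu i : k) * Polynomial.X) =
      (∏ i, (1 - Polynomial.C ((shiftedCoord v mu i + sgn (v i) : ℤ) : k) * Polynomial.X)) *
      ∏ i, (1 - Polynomial.C (shiftedCoord v lam i : k) * Polynomial.X) := by
    apply Polynomial.coe_injective k
    rw [Polynomial.coe_mul, Polynomial.coe_mul, ← hl, ← hm]
    ring
  have hms := map_eq_of_prod_one_sub_eq (k := k) (ι := Fin N ⊕ Fin N)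
    (f := Sum.elim (fun i => ((shiftedCoord v lam i + sgn (v i) : ℤ) : k))
      (fun i => (shiftedCoord v mu i : k)))
    (g := Sum.elim (fun i => ((shiftedCoord v mu i + sgn (v i) : ℤ) : k))
      (fun i => (shiftedCoord v lam i : k)))
    (by simpa only [Fintype.prod_sum_type, Sum.elim_inl, Sum.elim_inr] using hpoly)
  have hsum := congrArg (fun s : Multiset k => (s.map f).sum) hms
  simp only [Multiset.map_map] at hsum
  change ∑ x, f _ = ∑ x, f _ at hsum
  simp only [Fintype.sum_sum_type, Sum.elim_inl, Sum.elim_inr] at hsum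
  simp only [Finset.sum_sub_distrib]
  linarith

theorem form_eps (x : XT N) (i : Fin N) : form v x (eps i) = sgn (v i) * x i := by
  rw [form, Finset.sum_eq_single i]
  · simp [eps]
  · intro j _ hj
    simp [eps, hj]
  · simp

theorem rho_apply (i : Fin N) : rho v i = theta v i + if v i = 0 then 1 else 0 := by
  simp only [rho, Pi.add_apply, Finset.sum_apply, eps, Finset.sum_filter]
  congr 1
  rw [Finset.sum_eq_single i]
  · split_ifs <;> simp
  · intro j _ hj
    split_ifs <;> simp [hj.symm]
  · simp

theorem form_add_rho (lam : XT N) (i : Fin N) :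
    form v (lam + rho v) (eps i) = shiftedCoord v lam i + if v i = 0 then 1 else 0 := by
  have h1 : sgn (v i) * theta v i = ∑ k ∈ Finset.univ.filter (fun k => i < k), sgn (v k) := by
    rw [theta, Finset.mul_sum]
    refine Finset.sum_congr rfl fun k _ => ?_
    rw [sgn_add]
    linear_combination sgn (v k) * sgn_mul_self (v i)
  have h2 : sgn (v i) * (if v i = 0 then 1 else 0) = if v i = 0 then 1 else 0 := by
    split_ifs with h <;> simp [h, sgn]
  rw [form_eps, Pi.add_apply, rho_apply, shiftedCoord, ← h1]
  linear_combination h2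

theorem sum_sgn_mul_form (lam : XT N) :
    ∑ i, sgn (v i) * form v (lam + rho v) (eps i) = ∑ i, lam i + ∑ i, rho v i := by
  rw [← Finset.sum_add_distrib]
  refine Finset.sum_congr rfl fun i _ => ?_
  rw [form_eps, Pi.add_apply]
  linear_combination (lam i + rho v i) * sgn_mul_self (v i)

theorem sub_shiftedCoord_eq {k : Type*} [Ring k] (f : k → ℤ) (lam : XT N) (i : Fin N) :
    f ((shiftedCoord v lam i + sgn (v i) : ℤ) : k) - f (shiftedCoord v lam i : k) =
      sgn (v i) * (f (form v (lam + rho v) (eps i) : ℤ) -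
        f ((form v (lam + rho v) (eps i) - 1 : ℤ) : k)) := by
  rw [form_add_rho]
  by_cases h : v i = 0
  · simp [h, sgn]
  · simp [h, sgn, sub_eq_add_neg]

/-- In terms of `a_i = (λ + ρ, ε_i)`, the divisor of the generating function is
`∑ i, (-1)^{v_i} ([a_i] - [a_i - 1])` modulo `p`. -/
theorem sum_form_eq_of_eig_eq {k : Type*} [Field k] (p : ℕ) [CharP k p] {lam mu : XT N}
    (h : ∀ r, ((∑ i, sgn (v i) * gelfandEig v lam r i : ℤ) : k) =
      ((∑ i, sgn (v i) * gelfandEig v mu r i : ℤ) : k)) (f : ZMod p → ℤ) :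
    ∑ i, sgn (v i) * (f (form v (lam + rho v) (eps i) : ℤ) -
        f ((form v (lam + rho v) (eps i) - 1 : ℤ) : ZMod p)) =
      ∑ i, sgn (v i) * (f (form v (mu + rho v) (eps i) : ℤ) -
        f ((form v (mu + rho v) (eps i) - 1 : ℤ) : ZMod p)) := by
  -- `f` extends along the injection of the prime ring `ZMod p` into `k`.
  have hinj : Function.Injective (ZMod.castHom (dvd_refl p) k) := ZMod.castHom_injective k
  have hext : ∀ a : ℤ, Function.extend (ZMod.castHom (dvd_refl p) k) f 0 (a : k) =
      f (a : ZMod p) := by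
    intro a
    rw [← map_intCast (ZMod.castHom (dvd_refl p) k) a, hinj.extend_apply]
  have := sum_shiftedCoord_eq_of_eig_eq h (Function.extend (ZMod.castHom (dvd_refl p) k) f 0)
  simpa only [sub_shiftedCoord_eq, hext] using this

/-- The quadratic polynomial `m² + (2 - p) m` in the remainder `m` of `a - 1` modulo `p` has the
differences `2 m + 1 - p`, also across a multiple of `p`. -/
theorem val_sq_sub (q : ℕ) (a : ZMod (q + 1)) :
    (((a - 1).val : ℤ) ^ 2 + (1 - q) * (a - 1).val) -
      (((a - 1 - 1).val : ℤ) ^ 2 + (1 - q) * (a - 1 - 1).val) = 2 * (a - 1).val - q := by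
  generalize a - 1 = b
  by_cases hb : b = 0
  · subst hb
    have : ((0 - 1 : ZMod (q + 1))).val = q := by
      rw [zero_sub]
      exact ZMod.val_neg_one q
    rw [this]
    simp
    ring
  · obtain ⟨c, rfl⟩ : ∃ c, b = c + 1 := ⟨b - 1, by ring⟩
    have hc : (c + 1).val = c.val + 1 := by
      have hlt : c.val + 1 < q + 1 := by
        by_contra hlt
        have h1 := c.val_lt
        have h2 : c.val = q := by omega
        apply hb
        rw [← ZMod.natCast_zmod_val c, h2]
        exact_mod_cast ZMod.natCast_self (q + 1)
      have h3 := ZMod.val_cast_of_lt hlt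
      rwa [Nat.cast_add, ZMod.natCast_zmod_val, Nat.cast_one] at h3
    rw [add_sub_cancel_right, hc]
    push_cast
    ring

/-- The coefficient of `-δ` in the weight is determined by the sum of the `(-1)^{v_i} a_i` and the
differences modulo `p`: dividing with remainder leaves the sum of the remainders, which is a
sum of differences by `val_sq_sub`. -/
theorem sum_sgn_mul_floor_eq {q : ℕ} {a b : Fin N → ℤ}
    (hsum : ∑ i, sgn (v i) * a i = ∑ i, sgn (v i) * b i)
    (h : ∀ f : ZMod (q + 1) → ℤ,
      ∑ i, sgn (v i) * (f (a i : ℤ) - f ((a i - 1 : ℤ) : ZMod (q + 1))) =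
        ∑ i, sgn (v i) * (f (b i : ℤ) - f ((b i - 1 : ℤ) : ZMod (q + 1)))) :
    ∑ i, sgn (v i) * ((a i - 1) / ((q + 1 : ℕ) : ℤ)) =
      ∑ i, sgn (v i) * ((b i - 1) / ((q + 1 : ℕ) : ℤ)) := by
  have hf := h fun x => ((x - 1).val : ℤ) ^ 2 + (1 - q) * (x - 1).val
  simp only [Int.cast_sub, Int.cast_one, val_sq_sub] at hf
  have hmod : ∀ a : ℤ, ((((a : ZMod (q + 1)) - 1).val : ℕ) : ℤ) =
      a - 1 - ((q + 1 : ℕ) : ℤ) * ((a - 1) / ((q + 1 : ℕ) : ℤ)) := by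
    intro a
    have := ZMod.val_intCast (n := q + 1) (a - 1)
    push_cast at this ⊢
    rw [this, Int.emod_def]
  simp only [hmod] at hf
  have e : ∀ a : Fin N → ℤ, ∑ i, sgn (v i) *
      (2 * (a i - 1 - ((q + 1 : ℕ) : ℤ) * ((a i - 1) / ((q + 1 : ℕ) : ℤ))) - q) =
      2 * ∑ i, sgn (v i) * a i - (2 + q) * ∑ i, sgn (v i) -
        2 * ((q + 1 : ℕ) : ℤ) * ∑ i, sgn (v i) * ((a i - 1) / ((q + 1 : ℕ) : ℤ)) := by
    intro a
    rw [Finset.mul_sum, Finset.mul_sum, Finset.mul_sum, ← Finset.sum_sub_distrib,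
      ← Finset.sum_sub_distrib]
    exact Finset.sum_congr rfl fun i _ => by ring
  rw [e, e, hsum] at hf
  have hq : (2 * ((q + 1 : ℕ) : ℤ)) ≠ 0 := by positivity
  exact mul_left_cancel₀ hq (by linarith)

theorem sum_sgn_zsmul_gamma_eq (p : ℕ) {a b : Fin N → ℤ}
    (hsum : ∑ i, sgn (v i) * a i = ∑ i, sgn (v i) * b i)
    (h : ∀ f : ZMod p → ℤ,
      ∑ i, sgn (v i) * (f (a i : ℤ) - f ((a i - 1 : ℤ) : ZMod p)) =
        ∑ i, sgn (v i) * (f (b i : ℤ) - f ((b i - 1 : ℤ) : ZMod p))) :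
    ∑ i, sgn (v i) • gamma p (a i) = ∑ i, sgn (v i) • gamma p (b i) := by
  cases p with
  | zero =>
    change (∑ i, sgn (v i) • Finsupp.single (a i) 1 : ℤ →₀ ℤ) =
      ∑ i, sgn (v i) • Finsupp.single (b i) 1
    ext t
    -- The indicator of `t` is the difference function of the indicator of `[t, ∞)`.
    have ht := h fun x : ℤ => if t ≤ x then 1 else 0
    have key : ∀ x : ℤ, ((if t ≤ x then 1 else 0) - (if t ≤ x - 1 then 1 else 0) : ℤ) =
        (Finsupp.single x 1 : ℤ →₀ ℤ) t := by
      intro x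
      rw [Finsupp.single_apply]
      split_ifs <;> omega
    simp only [Finsupp.coe_finsetSum, Finset.sum_apply, Finsupp.coe_smul, Pi.smul_apply,
      smul_eq_mul, ← key]
    exact ht
  | succ q =>
    change (∑ i, sgn (v i) • ((-((a i - 1) / ((q + 1 : ℕ) : ℤ)),
        Finsupp.single (a i : ZMod (q + 1)) 1 -
          Finsupp.single ((a i - 1 : ℤ) : ZMod (q + 1)) 1) : ℤ × (ZMod (q + 1) →₀ ℤ))) =
      ∑ i, sgn (v i) • ((-((b i - 1) / ((q + 1 : ℕ) : ℤ)),
        Finsupp.single (b i : ZMod (q + 1)) 1 -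
          Finsupp.single ((b i - 1 : ℤ) : ZMod (q + 1)) 1) : ℤ × (ZMod (q + 1) →₀ ℤ))
    refine Prod.ext ?_ (Finsupp.ext fun t => ?_)
    · simp only [Prod.fst_sum, Prod.smul_fst, smul_eq_mul, mul_neg, Finset.sum_neg_distrib,
        sum_sgn_mul_floor_eq hsum h]
    · have ht := h fun x => (Finsupp.single x 1 : ZMod (q + 1) →₀ ℤ) t
      simpa only [Prod.snd_sum, Prod.smul_snd, Finsupp.coe_finsetSum, Finset.sum_apply,
        Finsupp.coe_smul, Pi.smul_apply, smul_eq_mul, Finsupp.coe_sub, Pi.sub_apply] using ht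

theorem wt_eq_of_eig_eq {k : Type*} [Field k] (p : ℕ) [CharP k p] {lam mu : XT N}
    (hsum : ∑ i, lam i = ∑ i, mu i)
    (h : ∀ r, ((∑ i, sgn (v i) * gelfandEig v lam r i : ℤ) : k) =
      ((∑ i, sgn (v i) * gelfandEig v mu r i : ℤ) : k)) :
    wt p v lam = wt p v mu :=
  sum_sgn_zsmul_gamma_eq p
    (by rw [sum_sgn_mul_form, sum_sgn_mul_form, hsum]) (sum_form_eq_of_eig_eq p h)

end Arithmetic

/-! ### Even central elements of the Kostant form -/

section Kostant

variable {N : ℕ} {v : Fin N → ZMod 2}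

theorem superRelations_e (v : Fin N → ZMod 2) : SuperRelations v (e v) := by
  intro i j k l
  have h := RingQuot.mkAlgHom_rel ℂ (Rel.bracket (v := v) i j k l)
  simp only [map_sub, map_mul, map_zsmul, apply_ite (RingQuot.mkAlgHom ℂ (Rel v)), map_zero] at h
  exact h

theorem commute_of_commute_e {u : UC v} (h : ∀ i j, Commute (e v i j) u) (y : UC v) :
    Commute y u := by
  obtain ⟨x, rfl⟩ := RingQuot.mkAlgHom_surjective ℂ (Rel v) y
  induction x using FreeAlgebra.induction with
  | grade0 r =>
    rw [AlgHom.commutes]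
    exact Algebra.commutes r u
  | grade1 q => exact h q.1 q.2
  | mul a b ha hb =>
    rw [map_mul]
    exact ha.mul_left hb
  | add a b ha hb =>
    rw [map_add]
    exact ha.add_left hb

theorem divPow_one (i j : Fin N) : divPow v i j 1 = e v i j := by
  simp [divPow]

theorem hBinom_one (i : Fin N) : hBinom v i 1 = e v i i := by
  simp [hBinom]

theorem e_mem_UZ (v : Fin N → ZMod 2) (i j : Fin N) : e v i j ∈ UZ v := by
  by_cases hij : i = j
  · subst hij
    exact hBinom_one (v := v) i ▸ mem_UZ (.binom i 1 le_rfl)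
  · rcases (by generalize v i + v j = x; revert x; decide : v i + v j = 0 ∨ v i + v j = 1)
      with h | h
    · exact divPow_one (v := v) i j ▸ mem_UZ (.even i j hij h 1 le_rfl)
    · exact mem_UZ (.odd i j h)

/-- The matrix unit `e_{ij}` as an element of the Kostant form. -/
def eUZ (v : Fin N → ZMod 2) (i j : Fin N) : UZ v := ⟨e v i j, e_mem_UZ v i j⟩

theorem superRelations_eUZ (v : Fin N → ZMod 2) : SuperRelations v (eUZ v) := by
  intro i j k l
  apply Subtype.ext
  have h := superRelations_e v i j k l
  simpa [eUZ, apply_ite Subtype.val, -zsmul_eq_mul] using h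

theorem coe_gelfandInv_eUZ (r : ℕ) :
    ((gelfandInv v (eUZ v) r : UZ v) : UC v) = gelfandInv v (e v) r :=
  map_gelfandInv (UZ v).val.toRingHom r

theorem one_mem_UCpart : (1 : UC v) ∈ UCpart v 0 :=
  Submodule.subset_span ⟨[], by simp, by simp⟩

theorem e_mem_UCpart (i j : Fin N) : e v i j ∈ UCpart v (v i + v j) :=
  Submodule.subset_span ⟨[(i, j)], by simp, by simp⟩

theorem mul_mem_UCpart {a b : ZMod 2} {x y : UC v} (hx : x ∈ UCpart v a)
    (hy : y ∈ UCpart v b) : x * y ∈ UCpart v (a + b) := by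
  have h := Submodule.mul_mem_mul hx hy
  rw [UCpart, UCpart, Submodule.span_mul_span] at h
  refine Submodule.span_mono ?_ h
  rintro _ ⟨_, ⟨w, hw, rfl⟩, _, ⟨w', hw', rfl⟩, rfl⟩
  exact ⟨w ++ w', by simp [hw, hw'], by simp⟩

theorem gelfandPower_mem_UCpart (r : ℕ) (i j : Fin N) :
    gelfandPower v (e v) r i j ∈ UCpart v (v i + v j) := by
  induction r generalizing i with
  | zero =>
    rw [gelfandPower]
    split_ifs with h
    · subst h
      rw [CharTwo.add_self_eq_zero]
      exact zsmul_mem one_mem_UCpart _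
    · exact zero_mem _
  | succ r ih =>
    rw [gelfandPower]
    refine sum_mem fun k _ => zsmul_mem ?_ _
    have h : v i + v j = (v i + v k) + (v k + v j) := by
      generalize v i = x; generalize v j = y; generalize v k = z
      revert x y z; decide
    rw [h]
    exact mul_mem_UCpart (e_mem_UCpart i k) (ih k)

theorem gelfandInv_mem_UCpart (r : ℕ) : gelfandInv v (e v) r ∈ UCpart v 0 :=
  sum_mem fun i _ => by
    simpa only [CharTwo.add_self_eq_zero] using gelfandPower_mem_UCpart (v := v) r i i

/-! ### Binomials of the Euler element -/

/-- The structure of a `ℚ≥0`-module on `U_ℂ`, which makes it a binomial ring. -/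
instance instModuleNNRatUC : Module ℚ≥0 (UC v) := Module.compHom _ (algebraMap ℚ≥0 ℂ)

theorem descPochhammer_smeval_eq_prod {R : Type*} [Ring R] (x : R) (r : ℕ) :
    (descPochhammer ℤ r).smeval x = ((List.range r).map (fun s : ℕ => x - (s : R))).prod := by
  induction r with
  | zero => simp [Polynomial.smeval_one]
  | succ r ih =>
    rw [descPochhammer_succ_right, Polynomial.smeval_mul, ih, List.range_succ, List.map_append,
      List.prod_append]
    simp [Polynomial.smeval_sub, Polynomial.smeval_X, Polynomial.smeval_natCast]

theorem factorial_smul_choose (x : UC v) (r : ℕ) :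
    (r.factorial : ℂ) • Ring.choose x r =
      ((List.range r).map (fun s : ℕ => x - (s : UC v))).prod := by
  rw [← descPochhammer_smeval_eq_prod, Ring.descPochhammer_eq_factorial_smul_choose,
    Nat.cast_smul_eq_nsmul]

/-- In the definition of `hBinom` the range `[0, …, r - 1]` is coerced to a list of elements of `U_ℂ`;
here it stays a list of natural numbers. -/
theorem hBinom_eq_smul_prod (i : Fin N) (r : ℕ) : hBinom v i r =
    ((r.factorial : ℂ)⁻¹) • ((List.range r).map (fun s : ℕ => e v i i - (s : UC v))).prod := by
  simp [hBinom, ← List.map_eq_flatMap, Function.comp_def]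

theorem choose_e_eq_hBinom (i : Fin N) (r : ℕ) : Ring.choose (e v i i) r = hBinom v i r := by
  rw [hBinom_eq_smul_prod, ← factorial_smul_choose, smul_smul, inv_mul_cancel₀, one_smul]
  exact_mod_cast r.factorial_ne_zero

theorem commute_choose {x y : UC v} (h : Commute y x) (r : ℕ) :
    Commute y (Ring.choose x r) := by
  have h1 : Commute y ((r.factorial : ℂ) • Ring.choose x r) := by
    rw [factorial_smul_choose]
    refine Commute.list_prod_right _ _ fun z hz => ?_
    obtain ⟨s, -, rfl⟩ := List.mem_map.mp hz
    exact h.sub_right (Nat.cast_commute s y).symm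
  have h2 := h1.smul_right ((r.factorial : ℂ)⁻¹)
  rwa [smul_smul, inv_mul_cancel₀ (by exact_mod_cast r.factorial_ne_zero), one_smul] at h2

theorem hBinom_mem_UCpart (i : Fin N) (r : ℕ) : hBinom v i r ∈ UCpart v 0 := by
  rw [hBinom_eq_smul_prod]
  refine Submodule.smul_mem _ _ ?_
  induction List.range r with
  | nil => exact one_mem_UCpart
  | cons s l ih =>
    rw [List.map_cons, List.prod_cons]
    have h1 : e v i i - (s : UC v) ∈ UCpart v 0 := by
      refine sub_mem (by simpa only [CharTwo.add_self_eq_zero] using e_mem_UCpart (v := v) i i) ?_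
      rw [← nsmul_one]
      exact nsmul_mem one_mem_UCpart s
    simpa using mul_mem_UCpart h1 ih

theorem commute_e_diag (i j : Fin N) : Commute (e v i i) (e v j j) := by
  have h := superRelations_e v i i j j
  have h1 : sgn ((v i + v i) * (v j + v j)) = 1 := by
    rw [CharTwo.add_self_eq_zero, zero_mul]; rfl
  rw [h1, one_smul, one_smul] at h
  refine sub_eq_zero.mp (h.trans ?_)
  by_cases hij : i = j
  · subst hij; simp
  · simp [hij]

/-- The Euler element `∑ i, h_i` is the first Gelfand invariant. -/
theorem gelfandInv_one {A : Type*} [Ring A] (E : Fin N → Fin N → A) :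
    gelfandInv v E 1 = ∑ i, E i i := by
  refine Finset.sum_congr rfl fun i _ => ?_
  simp only [gelfandPower, mul_ite, mul_zero, smul_ite, smul_zero, Finset.sum_ite_eq',
    Finset.mem_univ, if_true, mul_smul_comm, mul_one, smul_smul, sgn_mul_self, one_smul]

end Kostant

/-! ### Action on Verma modules and on composition factors -/

section Verma

variable {k : Type*} [Field k] {N : ℕ} {v : Fin N → ZMod 2}

/-- The ring homomorphism `u ↦ 1 ⊗ u` from the Kostant form to `Dist(G)`. -/
def toDistHom (k : Type*) [Field k] (v : Fin N → ZMod 2) : UZ v →+* Dist k v :=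
  (Algebra.TensorProduct.includeRight : UZ v →ₐ[ℤ] k ⊗[ℤ] (UZ v)).toRingHom

theorem toDistHom_apply (u : UZ v) : toDistHom k v u = toDist k v u := rfl

theorem commute_toDist {u : UZ v} (h : ∀ y : UC v, Commute y u) : ∀ d : Dist k v,
    Commute d (toDist k v u) := by
  change ∀ d : k ⊗[ℤ] (UZ v), d * ((1 : k) ⊗ₜ[ℤ] u) = ((1 : k) ⊗ₜ[ℤ] u) * d
  intro d
  induction d using TensorProduct.induction_on with
  | zero => rw [mul_zero, zero_mul]
  | tmul a y =>
    rw [Algebra.TensorProduct.tmul_mul_tmul, Algebra.TensorProduct.tmul_mul_tmul, mul_one, one_mul,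
      (Subtype.ext (h y) : y * u = u * y)]
  | add x y hx hy => rw [add_mul, mul_add, hx, hy]

/-- The canonical generator of the Verma module `M(λ)`. -/
def vermaGen (k : Type*) [Field k] (v : Fin N → ZMod 2) (lam : XT N) : Verma k v lam :=
  (vermaIdeal k v lam).mkQ 1

theorem smul_vermaGen_eq_zero {lam : XT N} {x : Dist k v} (hx : VermaRel k v lam x) :
    x • vermaGen k v lam = 0 := by
  change x • (vermaIdeal k v lam).mkQ 1 = 0
  rw [← map_smul, smul_eq_mul, mul_one]
  exact (Submodule.Quotient.mk_eq_zero _).mpr (Submodule.subset_span hx)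

theorem hBinom_smul_vermaGen (lam : XT N) (i : Fin N) (r : ℕ) (hr : 1 ≤ r) :
    toDist k v ⟨hBinom v i r, mem_UZ (.binom i r hr)⟩ • vermaGen k v lam =
      (Ring.choose (lam i) r : ℤ) • vermaGen k v lam := by
  have h := smul_vermaGen_eq_zero (VermaRel.torus (k := k) (v := v) (lam := lam) i r hr)
  rw [sub_smul, sub_eq_zero] at h
  rw [h, algebraMap_smul, Int.cast_smul_eq_zsmul]

theorem e_diag_smul_vermaGen (lam : XT N) (i : Fin N) :
    toDistHom k v (eUZ v i i) • vermaGen k v lam = lam i • vermaGen k v lam := by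
  have h := hBinom_smul_vermaGen (k := k) (v := v) lam i 1 le_rfl
  simp only [hBinom_one, Ring.choose_one_right] at h
  exact h

theorem e_smul_vermaGen_of_lt (lam : XT N) (i j : Fin N) (hij : i < j) :
    toDistHom k v (eUZ v i j) • vermaGen k v lam = 0 := by
  rcases (by generalize v i + v j = x; revert x; decide : v i + v j = 0 ∨ v i + v j = 1)
    with h | h
  · have h1 := smul_vermaGen_eq_zero (VermaRel.even (k := k) (lam := lam) i j hij h 1 le_rfl)
    simp only [divPow_one] at h1
    exact h1
  · exact smul_vermaGen_eq_zero (VermaRel.odd (k := k) (lam := lam) i j hij h)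

theorem gelfandInv_smul_vermaGen (lam : XT N) (r : ℕ) :
    toDist k v (gelfandInv v (eUZ v) r) • vermaGen k v lam =
      (∑ i, sgn (v i) * gelfandEig v lam r i) • vermaGen k v lam := by
  have hE : SuperRelations v (fun i j => toDistHom k v (eUZ v i j)) := by
    intro i j l m
    have h := congrArg (toDistHom k v) (superRelations_eUZ v i j l m)
    simp only [map_sub, map_mul, map_zsmul, apply_ite (toDistHom k v), map_zero] at h
    exact h
  rw [← toDistHom_apply, map_gelfandInv]
  exact gelfandInv_smul_highest hE (e_diag_smul_vermaGen lam) (e_smul_vermaGen_of_lt lam) r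

/-- By the Chu–Vandermonde identity the binomials of `∑ i ∈ S, h_i` are integral polynomials in
the binomials of the `h_i`; hence they lie in the Kostant form, and they act on the generator
of `M(λ)` through the corresponding binomials of `∑ i ∈ S, λ_i`, for all `λ`. -/
theorem choose_sum_mem_and_smul (k : Type*) [Field k] (S : Finset (Fin N)) (r : ℕ) :
    Ring.choose (∑ i ∈ S, e v i i) r ∈ UCpart v 0 ∧
    ∃ u : UZ v, (u : UC v) = Ring.choose (∑ i ∈ S, e v i i) r ∧
      ∀ lam : XT N, toDist k v u • vermaGen k v lam =
        (Ring.choose (∑ i ∈ S, lam i) r : ℤ) • vermaGen k v lam := by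
  classical
  induction S using Finset.induction_on generalizing r with
  | empty =>
    simp only [Finset.sum_empty, Ring.choose_zero_ite]
    by_cases hr : r = 0
    · simp only [hr, if_true]
      refine ⟨one_mem_UCpart, 1, rfl, fun lam => ?_⟩
      rw [← toDistHom_apply, map_one, one_smul, one_smul]
    · simp only [hr, if_false]
      refine ⟨zero_mem _, 0, rfl, fun lam => ?_⟩
      rw [← toDistHom_apply, map_zero, zero_smul, zero_smul]
  | insert a S ha ih =>
    have hcomm : Commute (e v a a) (∑ i ∈ S, e v i i) :=
      Commute.sum_right _ _ _ fun i _ => commute_e_diag a i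
    simp only [Finset.sum_insert ha]
    have hbin : ∀ n, ∃ u : UZ v, (u : UC v) = Ring.choose (e v a a) n ∧
        ∀ lam : XT N, toDist k v u • vermaGen k v lam =
          (Ring.choose (lam a) n : ℤ) • vermaGen k v lam := by
      intro n
      rcases Nat.eq_zero_or_pos n with rfl | hn
      · refine ⟨1, by rw [Ring.choose_zero_right]; rfl, fun lam => ?_⟩
        rw [← toDistHom_apply, map_one, one_smul, Ring.choose_zero_right, one_smul]
      · exact ⟨⟨hBinom v a n, mem_UZ (.binom a n hn)⟩, (choose_e_eq_hBinom a n).symm,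
          fun lam => hBinom_smul_vermaGen lam a n hn⟩
    choose x hx hx' using hbin
    choose hpart y hy hy' using ih
    rw [Ring.add_choose_eq r hcomm]
    refine ⟨sum_mem fun q _ => ?_,
      ∑ q ∈ Finset.HasAntidiagonal.antidiagonal r, x q.1 * y q.2, ?_, fun lam => ?_⟩
    · have h := mul_mem_UCpart (hBinom_mem_UCpart (v := v) a q.1) (hpart q.2)
      rwa [add_zero, ← choose_e_eq_hBinom] at h
    · rw [AddSubmonoidClass.coe_finsetSum]
      exact Finset.sum_congr rfl fun q _ => by rw [MulMemClass.coe_mul, hx, hy]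
    · rw [← toDistHom_apply, map_sum, Finset.sum_smul, Ring.add_choose_eq r (Commute.all _ _),
        Finset.sum_smul]
      refine Finset.sum_congr rfl fun q _ => ?_
      rw [map_mul, mul_smul, toDistHom_apply, toDistHom_apply, hy', smul_comm, hx', smul_smul,
        mul_comm]

/-- A central element acts on `M(λ)` by its eigenvalue on the generator. -/
theorem smul_verma_of_commute {lam : XT N} {z : Dist k v} (hz : ∀ d, Commute d z) {c : ℤ}
    (hc : z • vermaGen k v lam = c • vermaGen k v lam) (m : Verma k v lam) :
    z • m = c • m := by
  obtain ⟨d, rfl⟩ := (vermaIdeal k v lam).mkQ_surjective m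
  have h : (vermaIdeal k v lam).mkQ d = d • vermaGen k v lam := by
    change _ = d • (vermaIdeal k v lam).mkQ 1
    rw [← map_smul, smul_eq_mul, mul_one]
  change z • (show Verma k v lam from (vermaIdeal k v lam).mkQ d) =
    c • (show Verma k v lam from (vermaIdeal k v lam).mkQ d)
  rw [show (show Verma k v lam from (vermaIdeal k v lam).mkQ d) = d • vermaGen k v lam from h,
    smul_smul, ← (hz d).eq, mul_smul, hc, smul_comm]

theorem smul_irr_of_commute {mu : XT N} {z : Dist k v} (hz : ∀ d, Commute d z) {c : ℤ}
    (hc : z • vermaGen k v mu = c • vermaGen k v mu) (m : Irr k v mu) :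
    z • m = c • m := by
  obtain ⟨m, rfl⟩ := (vermaRad k v mu).mkQ_surjective m
  have h := congrArg (vermaRad k v mu).mkQ (smul_verma_of_commute hz hc m)
  rw [map_smul, map_zsmul] at h
  exact h

/-- An even central element of the Kostant form has the same eigenvalue on `M(λ)` and on `M(μ)` if
`L(μ)` is a composition factor of `M(λ)`. -/
theorem eigenvalue_eq_of_isCompositionFactor {lam mu : XT N}
    (h : IsCompositionFactor v (irrGrading k v mu) (vermaGrading k v lam)) {u : UZ v}
    (hcomm : ∀ y : UC v, Commute y u) (heven : (u : UC v) ∈ UCpart v 0) {a b : ℤ}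
    (ha : toDist k v u • vermaGen k v lam = a • vermaGen k v lam)
    (hb : toDist k v u • vermaGen k v mu = b • vermaGen k v mu) : (a : k) = (b : k) := by
  obtain ⟨S, T, -, -, -, ⟨hnt, -⟩, f, ⟨f₀, f₁, ⟨-, h₀⟩, ⟨-, h₁⟩, hf⟩, -⟩ := h
  have hz := commute_toDist (k := k) hcomm
  have hmem : toDist k v u ∈ distPart k v 0 := Submodule.subset_span ⟨u, heven, rfl⟩
  obtain ⟨m, hm⟩ := exists_ne (0 : T ⧸ S.submoduleOf T)
  have hm1 : toDist k v u • m = a • m := by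
    obtain ⟨t, rfl⟩ := (S.submoduleOf T).mkQ_surjective m
    rw [← map_smul, ← map_zsmul]
    congr 1
    exact Subtype.ext (smul_verma_of_commute hz ha t)
  have hfm : f (toDist k v u • m) = toDist k v u • f m := by
    have e : ∀ x, f x = f₀ x + f₁ x := fun x => LinearMap.congr_fun hf x
    rw [e, e, h₀ 0 _ hmem, h₁ 0 _ hmem, mul_zero, mul_zero, smul_add]
    simp [sgn]
  rw [hm1, map_zsmul, smul_irr_of_commute hz hb, ← Int.cast_smul_eq_zsmul k,
    ← Int.cast_smul_eq_zsmul k] at hfm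
  exact smul_left_injective k (by simpa using hm : f m ≠ 0) hfm

/-- The binomials of an integer, read in a field of any characteristic, determine the integer. -/
theorem eq_of_choose_cast_eq (k : Type*) [Field k] {x y : ℤ}
    (h : ∀ r : ℕ, ((Ring.choose x r : ℤ) : k) = ((Ring.choose y r : ℤ) : k)) : x = y := by
  wlog hxy : y ≤ x generalizing x y
  · exact (this (fun r => (h r).symm) (le_of_not_ge hxy)).symm
  obtain ⟨n, rfl⟩ := Int.le.dest hxy
  -- By Chu–Vandermonde and induction, all `choose n r` with `r ≥ 1` vanish in `k`.
  have hn : ∀ r : ℕ, 1 ≤ r → ((Ring.choose (n : ℤ) r : ℤ) : k) = 0 := by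
    intro r
    induction r using Nat.strong_induction_on with
    | _ r ih =>
      intro hr
      have hr' := h r
      have hne : ((r, 0) : ℕ × ℕ) ≠ (0, r) := fun h => by
        have := congrArg Prod.fst h
        simp only at this
        omega
      rw [Ring.add_choose_eq r (Commute.all _ _), Int.cast_sum,
        Finset.sum_eq_add_of_mem (r, 0) (0, r) (by simp) (by simp) hne] at hr'
      · simpa using hr'
      · rintro ⟨i, j⟩ hij ⟨h1, h2⟩
        rw [Finset.HasAntidiagonal.mem_antidiagonal] at hij
        simp only [ne_eq, Prod.mk.injEq, not_and] at h1 h2 hij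
        rw [Int.cast_mul, ih j (by omega) (by omega), mul_zero]
  rcases Nat.eq_zero_or_pos n with rfl | hpos
  · simp
  · have := hn n hpos
    rw [Ring.choose_natCast, Nat.choose_self] at this
    simp at this

end Verma

end GLSuper

end

theorem theoremT {k : Type*} [Field k] (p : ℕ) [CharP k p] {N : ℕ} (v : Fin N → ZMod 2)
    (lam mu : GLSuper.XT N)
    (h : GLSuper.IsCompositionFactor v
      (GLSuper.irrGrading k v mu) (GLSuper.vermaGrading k v lam)) :
    GLSuper.wt p v lam = GLSuper.wt p v mu := by
  refine GLSuper.wt_eq_of_eig_eq (k := k) p ?_ fun r => ?_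
  · refine GLSuper.eq_of_choose_cast_eq k fun r => ?_
    obtain ⟨heven, u, hu, hsmul⟩ := GLSuper.choose_sum_mem_and_smul (v := v) k Finset.univ r
    refine GLSuper.eigenvalue_eq_of_isCompositionFactor h (u := u) ?_ (hu ▸ heven) (hsmul lam)
      (hsmul mu)
    rw [hu, ← GLSuper.gelfandInv_one]
    exact fun y => GLSuper.commute_choose (GLSuper.commute_of_commute_e
      (GLSuper.commute_gelfandInv (GLSuper.superRelations_e v) 1) y) r
  · refine GLSuper.eigenvalue_eq_of_isCompositionFactor h ?_ ?_
      (GLSuper.gelfandInv_smul_vermaGen lam r) (GLSuper.gelfandInv_smul_vermaGen mu r)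
    · rw [GLSuper.coe_gelfandInv_eUZ]
      exact GLSuper.commute_of_commute_e
        (GLSuper.commute_gelfandInv (GLSuper.superRelations_e v) r)
    · rw [GLSuper.coe_gelfandInv_eUZ]
      exact GLSuper.gelfandInv_mem_UCpart r
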